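/- Theorem 9 (mean flux theorem, modified Helmholtz). Let $m \ge 2$, let $D \subset \mathbb{R}^m$ be a domain (a nonempty, open and connected set, not necessarily bounded), let $\mu > 0$, and let $v \in C^2(D)$ be a real- or complex-valued solution of $\nabla^2 v - \mu^2 v = 0$ in $D$. Then for every open ball $B_r(x) = \{ y : |y - x| < r \}$, $r > 0$, that is admissible, i.e. whose closure is contained in $D$, the normal derivative $\partial v / \partial n$ is integrable over $\partial B_r(x)$ and $$\int_{\partial B_r(x)} \frac{\partial v}{\partial n_y} \, dS_y = \mu^2 \left( \frac{2 \pi r}{\mu} \right)^{m/2} I_{m/2}(\mu r) \, v(x).$$ Here $n$ is the exterior unit normal to $\partial B_r(x)$, $dS$ is the surface measure, and $I_\nu(z) = \sum_{k=0}^{\infty} \frac{(z/2)^{2k+\nu}}{k! \, \Gamma(k+\nu+1)}$ is the modified Bessel function of order $\nu$. -/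

import Mathlib

noncomputable section

namespace MeanFlux

/-- The modified Bessel function of the first kind `I_ν (z)`, of real order `ν`, at a real `z > 0`:
`I_ν (z) = ∑ₖ (z / 2) ^ (2 k + ν) / (k! Γ (k + ν + 1))`. -/
def besselI (ν z : ℝ) : ℝ :=
  ∑' k : ℕ, (z / 2) ^ (2 * (k : ℝ) + ν) / ((k.factorial : ℝ) * Real.Gamma ((k : ℝ) + ν + 1))

/-- The surface measure `dS` of the sphere `∂B_r (x)` in `ℝ^m`, as a measure on `ℝ^m`:
the image of `r ^ (m - 1)` times the surface measure of the unit sphere under `ω ↦ x + r ω`. -/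
def sphereMeasure {m : ℕ} (x : EuclideanSpace ℝ (Fin m)) (r : ℝ) :
    MeasureTheory.Measure (EuclideanSpace ℝ (Fin m)) :=
  ENNReal.ofReal (r ^ (m - 1)) •
    MeasureTheory.Measure.map
      (fun ω : Metric.sphere (0 : EuclideanSpace ℝ (Fin m)) 1 =>
        x + r • (ω : EuclideanSpace ℝ (Fin m)))
      (MeasureTheory.volume : MeasureTheory.Measure (EuclideanSpace ℝ (Fin m))).toSphere

/-- The exterior unit normal to the sphere `∂B_r (x)` at its point `y`. -/
def sphereNormal {m : ℕ} (x : EuclideanSpace ℝ (Fin m)) (r : ℝ)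
    (y : EuclideanSpace ℝ (Fin m)) : EuclideanSpace ℝ (Fin m) :=
  r⁻¹ • (y - x)

/-- The derivative `∂v/∂n` of `v` at the point `y` of the sphere `∂B_r (x)`, along the exterior
unit normal. -/
def normalDeriv {m : ℕ} {𝕜 : Type*} [RCLike 𝕜] (v : EuclideanSpace ℝ (Fin m) → 𝕜)
    (x : EuclideanSpace ℝ (Fin m)) (r : ℝ) (y : EuclideanSpace ℝ (Fin m)) : 𝕜 :=
  fderiv ℝ v y (sphereNormal x r y)

/-- The ball `B_r (x)` is admissible for `D`: it has positive radius and its closure lies in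
`D`. -/
def IsAdmissibleBall {m : ℕ} (D : Set (EuclideanSpace ℝ (Fin m)))
    (x : EuclideanSpace ℝ (Fin m)) (r : ℝ) : Prop :=
  0 < r ∧ closure (Metric.ball x r) ⊆ D

end MeanFlux

end

open MeasureTheory Set Filter Topology Metric Module

namespace MeanFlux

/-! Let `F s` be the integral of `v (x + s ω)` over the unit sphere and `S s` that of the radial
derivative, so that `F' = S`. The divergence theorem on the ball of radius `ρ`, with `Δv = c v` and
`c = μ ^ 2`, gives `ρ ^ (d - 1) S ρ = c ∫₀^ρ s ^ (d - 1) F s ds`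
(`pow_smul_integral_sphere_fderiv`). Together these determine `F` from `F 0`. Substituting them into
each other repeatedly yields the even power series with coefficients `radialCoeff`, and a remainder
that tends to zero (`norm_mean_sub_le`, `flux_eq_tsum`). Since `F 0` is the area of the unit sphere
times `v x`, the flux is an explicit series times `v x`, and comparing terms gives the Bessel factor
(`tsum_radialCoeff_mul_area`).

The divergence theorem on balls is obtained weakly: Green's identity against compactly supported
radial functions, written in polar coordinates, is an identity tested against functions of the
radius, and continuity makes it pointwise.

A cutoff makes `v` of class `C²` on the whole space without changing it near the closed ball. -/

theorem integrable_sphere {E W : Type*} [NormedAddCommGroup E] [InnerProductSpace ℝ E]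
    [FiniteDimensional ℝ E] [MeasurableSpace E] [BorelSpace E] [NormedAddCommGroup W]
    (ν : Measure E) [ν.IsAddHaarMeasure]
    {f : sphere (0 : E) 1 → W} (hf : Continuous f) : Integrable f ν.toSphere :=
  hf.integrable_of_hasCompactSupport (HasCompactSupport.of_compactSpace f)

/-! ### The Laplacian in an orthonormal basis -/

section Laplacian

variable {E W : Type*} [NormedAddCommGroup E] [InnerProductSpace ℝ E] [FiniteDimensional ℝ E]
  [NormedAddCommGroup W] [NormedSpace ℝ W]

/-- The Laplacian as the sum of second directional derivatives. -/
theorem laplacian_eq_sum_fderiv {ι : Type*} [Fintype ι] (b : OrthonormalBasis ι ℝ E)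
    {v : E → W} (hv : ContDiff ℝ 2 v) (y : E) :
    Laplacian.laplacian v y = ∑ i, fderiv ℝ (fun z => fderiv ℝ v z (b i)) y (b i) := by
  rw [InnerProductSpace.laplacian_eq_iteratedFDeriv_orthonormalBasis v b]
  refine Finset.sum_congr rfl fun i _ => ?_
  have hd : DifferentiableAt ℝ (fderiv ℝ v) y :=
    (hv.fderiv_right (m := 1) (by norm_num)).differentiable one_ne_zero y
  rw [iteratedFDeriv_two_apply, fderiv_clm_apply hd (differentiableAt_const _)]
  simp

theorem continuous_laplacian {v : E → W} (hv : ContDiff ℝ 2 v) :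
    Continuous (Laplacian.laplacian v) := by
  rw [InnerProductSpace.laplacian_eq_iteratedFDeriv_stdOrthonormalBasis]
  have := hv.continuous_iteratedFDeriv (m := 2) le_rfl
  fun_prop

end Laplacian

/-! ### Polar coordinates, spherical means and Green's identity -/

section SphericalMean

variable {E W : Type*} [NormedAddCommGroup E] [InnerProductSpace ℝ E] [FiniteDimensional ℝ E]
  [MeasurableSpace E] [BorelSpace E] [NormedAddCommGroup W] [NormedSpace ℝ W]

/-- Integration in polar coordinates. -/
theorem integral_eq_integral_Ioi_sphere [Nontrivial E] (ν : Measure E) [ν.IsAddHaarMeasure]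
    {f : E → W} (hf : Integrable f ν) :
    ∫ y, f y ∂ν =
      ∫ s in Ioi (0 : ℝ), s ^ (finrank ℝ E - 1) • ∫ ω, f (s • (ω : E)) ∂ν.toSphere := by
  have hmp := ν.measurePreserving_homeomorphUnitSphereProd
  have hme := (homeomorphUnitSphereProd E).measurableEmbedding
  have hcomp : (fun p : sphere (0 : E) 1 × Ioi (0 : ℝ) => f ((p.2 : ℝ) • (p.1 : E))) ∘
      homeomorphUnitSphereProd E = fun y : ({0}ᶜ : Set E) => f y := by
    funext y
    have hy : ‖(y : E)‖ ≠ 0 := norm_ne_zero_iff.2 y.2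
    simp [smul_smul, hy]
  have hint : Integrable (fun p : sphere (0 : E) 1 × Ioi (0 : ℝ) => f ((p.2 : ℝ) • (p.1 : E)))
      (ν.toSphere.prod (.volumeIoiPow (finrank ℝ E - 1))) := by
    rw [← hmp.integrable_comp_emb hme, hcomp]
    have := (integrableOn_iff_comap_subtypeVal
      (measurableSet_singleton (0 : E)).compl).1 (hf.integrableOn (s := {0}ᶜ))
    exact this
  calc
    ∫ y, f y ∂ν = ∫ y : ({0}ᶜ : Set E), f y ∂(ν.comap (↑)) := by
      rw [integral_subtype_comap (measurableSet_singleton _).compl f, restrict_compl_singleton]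
    _ = ∫ p : sphere (0 : E) 1 × Ioi (0 : ℝ), f ((p.2 : ℝ) • (p.1 : E))
          ∂(ν.toSphere.prod (.volumeIoiPow (finrank ℝ E - 1))) := by
      rw [← hmp.integral_comp hme]
      exact congrArg (fun g => ∫ y, g y ∂(ν.comap (↑))) hcomp.symm
    _ = ∫ s : Ioi (0 : ℝ), ∫ ω, f ((s : ℝ) • (ω : E)) ∂ν.toSphere
          ∂(.volumeIoiPow (finrank ℝ E - 1)) := integral_prod_symm _ hint
    _ = _ := by
      simp only [Measure.volumeIoiPow, ENNReal.ofReal]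
      rw [integral_withDensity_eq_integral_smul,
        integral_subtype_comap measurableSet_Ioi fun a ↦
          Real.toNNReal (a ^ (finrank ℝ E - 1)) • ∫ ω, f (a • (ω : E)) ∂ν.toSphere,
        setIntegral_congr_fun measurableSet_Ioi fun x hx ↦ ?_]
      · rw [NNReal.smul_def, Real.coe_toNNReal _ (pow_nonneg hx.out.le _)]
      · exact (measurable_subtype_coe.pow_const _).real_toNNReal

theorem continuous_integral_sphere (ν : Measure E) [ν.IsAddHaarMeasure]
    {f : ℝ → E → W} (hf : Continuous f.uncurry) :
    Continuous fun s : ℝ => ∫ ω : sphere (0 : E) 1, f s ω ∂ν.toSphere := by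
  have h : Continuous (fun (s : ℝ) (ω : sphere (0 : E) 1) => f s ω).uncurry :=
    hf.comp (f := fun p : ℝ × sphere (0 : E) 1 => (p.1, (p.2 : E))) (by fun_prop)
  have := continuous_parametric_integral_of_continuous (μ := ν.toSphere) h isCompact_univ
  simpa using this

/-- The derivative of the spherical mean with respect to the radius is the mean of the radial
derivative. -/
theorem hasDerivAt_integral_sphere (ν : Measure E) [ν.IsAddHaarMeasure]
    {v : E → W} (hv : ContDiff ℝ 1 v) (x : E) (s : ℝ) :
    HasDerivAt (fun s : ℝ => ∫ ω : sphere (0 : E) 1, v (x + s • (ω : E)) ∂ν.toSphere)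
      (∫ ω : sphere (0 : E) 1, fderiv ℝ v (x + s • (ω : E)) ω ∂ν.toSphere) s := by
  have hc : Continuous fun p : ℝ × sphere (0 : E) 1 =>
      fderiv ℝ v (x + p.1 • (p.2 : E)) p.2 := by
    have := hv.continuous_fderiv one_ne_zero
    fun_prop
  -- Compactness of the radii near `s` times the sphere gives a constant dominating function.
  obtain ⟨C, hC⟩ := ((isCompact_closedBall s 1).prod
    (isCompact_univ (X := sphere (0 : E) 1))).exists_bound_of_continuousOn hc.continuousOn
  have hvc := hv.continuous
  refine (hasDerivAt_integral_of_dominated_loc_of_deriv_le (bound := fun _ => C)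
    (F := fun s (ω : sphere (0 : E) 1) => v (x + s • (ω : E)))
    (F' := fun s (ω : sphere (0 : E) 1) => fderiv ℝ v (x + s • (ω : E)) ω)
    (closedBall_mem_nhds s one_pos) ?_ ?_ ?_ ?_ ?_ ?_).2
  · exact Eventually.of_forall fun t =>
      (integrable_sphere ν (by fun_prop)).aestronglyMeasurable
  · exact integrable_sphere ν (by fun_prop)
  · exact (integrable_sphere ν
      (hc.comp (Continuous.prodMk_right s))).aestronglyMeasurable
  · exact Eventually.of_forall fun ω t ht => hC (t, ω) ⟨ht, mem_univ _⟩
  · exact integrable_const C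
  · refine Eventually.of_forall fun ω t _ => ?_
    have h1 : HasDerivAt (fun t : ℝ => x + t • (ω : E)) (ω : E) t := by
      simpa using ((hasDerivAt_id t).smul_const (ω : E)).const_add x
    exact ((hv.differentiable one_ne_zero _).hasFDerivAt).comp_hasDerivAt t h1

/-- Green's first identity against a compactly supported function. -/
theorem integral_smul_laplacian (ν : Measure E) [ν.IsAddHaarMeasure] {ι : Type*} [Fintype ι]
    (b : OrthonormalBasis ι ℝ E) {v : E → W} (hv : ContDiff ℝ 2 v)
    {φ : E → ℝ} (hφ : ContDiff ℝ 1 φ) (hφc : HasCompactSupport φ) :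
    ∫ y, φ y • Laplacian.laplacian v y ∂ν =
      -∫ y, fderiv ℝ v y (∑ i, fderiv ℝ φ y (b i) • b i) ∂ν := by
  have hd : ContDiff ℝ 1 (fderiv ℝ v) := hv.fderiv_right (m := 1) (by norm_num)
  have hdi : ∀ i, ContDiff ℝ 1 (fun z => fderiv ℝ v z (b i)) := fun i =>
    hd.clm_apply contDiff_const
  have hφ' := hφ.continuous_fderiv one_ne_zero
  have hI1 : ∀ i, Integrable (fun y => φ y • fderiv ℝ (fun z => fderiv ℝ v z (b i)) y (b i)) ν :=
    fun i => Continuous.integrable_of_hasCompactSupport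
      (hφ.continuous.smul (((hdi i).continuous_fderiv one_ne_zero).clm_apply continuous_const))
      hφc.smul_right
  have hφi : ∀ i, HasCompactSupport (fun y => fderiv ℝ φ y (b i)) := fun i =>
    hφc.fderiv_apply ℝ (b i)
  have hI2 : ∀ i, Integrable (fun y => fderiv ℝ φ y (b i) • fderiv ℝ v y (b i)) ν :=
    fun i => Continuous.integrable_of_hasCompactSupport
      ((hφ'.clm_apply continuous_const).smul (hdi i).continuous) (hφi i).smul_right
  have hI3 : ∀ i, Integrable (fun y => φ y • fderiv ℝ v y (b i)) ν :=
    fun i => Continuous.integrable_of_hasCompactSupport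
      (hφ.continuous.smul (hdi i).continuous) hφc.smul_right
  simp_rw [laplacian_eq_sum_fderiv b hv, Finset.smul_sum, map_sum, map_smul]
  rw [integral_finsetSum _ fun i _ => hI1 i, integral_finsetSum _ fun i _ => hI2 i,
    ← Finset.sum_neg_distrib]
  exact Finset.sum_congr rfl fun i _ =>
    integral_smul_fderiv_eq_neg_fderiv_smul_of_integrable (hI2 i) (hI1 i) (hI3 i)
      (fun y _ => hφ.differentiable one_ne_zero y)
      (fun y _ => (hdi i).differentiable one_ne_zero y)

end SphericalMean

end MeanFlux

namespace MeanFlux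

/-! ### The divergence theorem on balls, by radial test functions -/

section Flux

variable {E W : Type*} [NormedAddCommGroup E] [InnerProductSpace ℝ E] [FiniteDimensional ℝ E]
  [MeasurableSpace E] [BorelSpace E] [NormedAddCommGroup W] [NormedSpace ℝ W]

/-- Green's first identity against a radial function, in polar coordinates. -/
theorem integral_radial_smul_laplacian [Nontrivial E] (ν : Measure E) [ν.IsAddHaarMeasure]
    {v : E → W} (hv : ContDiff ℝ 2 v) (x : E) {h h' : ℝ → ℝ} (hh : ∀ u, HasDerivAt h (h' u) u)
    (hh' : Continuous h') {R : ℝ} (hR : ∀ u, R ^ 2 ≤ u → h u = 0) (hR0 : 0 ≤ R) :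
    ∫ s in Ioi (0 : ℝ), s ^ (finrank ℝ E - 1) • (h (s ^ 2) •
        ∫ ω : sphere (0 : E) 1, Laplacian.laplacian v (x + s • (ω : E)) ∂ν.toSphere) =
      -∫ s in Ioi (0 : ℝ), s ^ (finrank ℝ E - 1) • ((2 * s * h' (s ^ 2)) •
        ∫ ω : sphere (0 : E) 1, fderiv ℝ v (x + s • (ω : E)) ω ∂ν.toSphere) := by
  -- Using the squared distance keeps `φ` differentiable at the centre; its gradient is `2 h' (‖y -
  -- x‖ ^ 2) (y - x)`.
  set φ : E → ℝ := fun y => h (‖y - x‖ ^ 2) with hφ_def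
  have hh1 : ContDiff ℝ 1 h := by
    rw [contDiff_one_iff_deriv]
    refine ⟨fun u => (hh u).differentiableAt, ?_⟩
    rwa [show deriv h = h' from funext fun u => (hh u).deriv]
  have hφ : ContDiff ℝ 1 φ := hh1.comp ((contDiff_id.sub contDiff_const).norm_sq ℝ)
  have hφc : HasCompactSupport φ := by
    refine HasCompactSupport.intro (isCompact_closedBall x R) fun y hy => hR _ ?_
    rw [mem_closedBall, not_le, dist_eq_norm] at hy
    exact pow_le_pow_left₀ hR0 hy.le 2
  have hφ' : ∀ y b, fderiv ℝ φ y b = 2 * h' (‖y - x‖ ^ 2) * inner ℝ (y - x) b := by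
    intro y b
    have h1 : HasFDerivAt (fun y : E => y - x) (ContinuousLinearMap.id ℝ E) y :=
      (hasFDerivAt_id y).sub_const x
    have h2 := (hh (‖y - x‖ ^ 2)).comp_hasFDerivAt y h1.norm_sq
    rw [show fderiv ℝ φ y = _ from h2.fderiv]
    simp [inner_sub_left]
    ring
  let b := stdOrthonormalBasis ℝ E
  have hgrad : ∀ y, ∑ i, fderiv ℝ φ y (b i) • b i = (2 * h' (‖y - x‖ ^ 2)) • (y - x) := by
    intro y
    simp_rw [hφ', mul_smul _ (inner ℝ _ _), ← Finset.smul_sum]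
    congr 1
    exact (Finset.sum_congr rfl fun i _ => by rw [real_inner_comm]).trans (b.sum_repr' (y - x))
  have hG := integral_smul_laplacian ν b hv hφ hφc
  simp_rw [hgrad] at hG
  have hL := continuous_laplacian hv
  have hv' := hv.continuous_fderiv two_ne_zero
  have hI1 : Integrable (fun y => φ y • Laplacian.laplacian v y) ν :=
    (hφ.continuous.smul hL).integrable_of_hasCompactSupport hφc.smul_right
  have hI2 : Integrable (fun y => fderiv ℝ v y ((2 * h' (‖y - x‖ ^ 2)) • (y - x))) ν := by
    refine Continuous.integrable_of_hasCompactSupport (by fun_prop) ?_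
    refine (hφc.fderiv ℝ).mono fun y hy hy0 => hy ?_
    have : ∑ i, fderiv ℝ φ y (b i) • b i = 0 := by simp [hy0]
    rw [hgrad] at this
    simp only [this, map_zero]
  rw [← integral_add_left_eq_self _ x, ← integral_add_left_eq_self (fun y => fderiv ℝ v y _) x,
    integral_eq_integral_Ioi_sphere ν (hI1.comp_add_left x),
    integral_eq_integral_Ioi_sphere ν (hI2.comp_add_left x)] at hG
  have hnorm : ∀ s : ℝ, 0 < s → ∀ ω : sphere (0 : E) 1, ‖s • (ω : E)‖ = s := by
    intro s hs ω
    simp [norm_smul, abs_of_pos hs]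
  rw [setIntegral_congr_fun measurableSet_Ioi fun s hs => ?_, hG,
    setIntegral_congr_fun measurableSet_Ioi fun s hs => ?_]
  · congr 1
    rw [← integral_smul]
    refine integral_congr_ae (Eventually.of_forall fun ω => ?_)
    simp only [add_sub_cancel_left, hnorm s hs, map_smul, smul_smul]
    congr 1
    ring
  · congr 1
    rw [← integral_smul]
    refine integral_congr_ae (Eventually.of_forall fun ω => ?_)
    simp only [φ, add_sub_cancel_left, hnorm s hs]

/-- The divergence theorem for the gradient of `v` on a ball: the flux of `∇v` through the sphere
is the integral of the Laplacian over the ball, in polar coordinates. -/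
theorem pow_smul_integral_sphere_fderiv [Nontrivial E] [CompleteSpace W]
    (ν : Measure E) [ν.IsAddHaarMeasure]
    {v : E → W} (hv : ContDiff ℝ 2 v) (x : E) {ρ : ℝ} (hρ : 0 < ρ) :
    ρ ^ (finrank ℝ E - 1) • ∫ ω : sphere (0 : E) 1, fderiv ℝ v (x + ρ • (ω : E)) ω ∂ν.toSphere =
      ∫ s in (0 : ℝ)..ρ, s ^ (finrank ℝ E - 1) •
        ∫ ω : sphere (0 : E) 1, Laplacian.laplacian v (x + s • (ω : E)) ∂ν.toSphere := by
  set n := finrank ℝ E - 1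
  set S : ℝ → W := fun s => ∫ ω : sphere (0 : E) 1, fderiv ℝ v (x + s • (ω : E)) ω ∂ν.toSphere
    with hS_def
  set L : ℝ → W := fun s =>
    ∫ ω : sphere (0 : E) 1, Laplacian.laplacian v (x + s • (ω : E)) ∂ν.toSphere with hL_def
  have hv' := hv.continuous_fderiv two_ne_zero
  have hΔ := continuous_laplacian hv
  have hS : Continuous S := continuous_integral_sphere ν
    (f := fun s y => fderiv ℝ v (x + s • y) y) (by fun_prop)
  have hL : Continuous L := continuous_integral_sphere ν
    (f := fun s y => Laplacian.laplacian v (x + s • y)) (by fun_prop)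
  have hg : Continuous fun s : ℝ => s ^ n • L s := by fun_prop
  set H : ℝ → W := fun ρ => ∫ s in (0 : ℝ)..ρ, s ^ n • L s with hH_def
  have hHd : ∀ s, HasDerivAt H (s ^ n • L s) s := fun s =>
    intervalIntegral.integral_hasDerivAt_right (hg.intervalIntegrable _ _)
      (hg.stronglyMeasurableAtFilter _ _) hg.continuousAt
  have hH : Continuous H := continuous_iff_continuousAt.2 fun s => (hHd s).continuousAt
  -- The factor `2 s` comes from differentiating `h (s ^ 2)`; it is nonzero for `s > 0` and is
  -- cancelled at the end.
  set f : ℝ → W := fun s => (2 * s) • (s ^ n • S s - H s) with hf_def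
  have hf : Continuous f := by fun_prop
  have key : ∀ᵐ s : ℝ, s ∈ Ioi (0 : ℝ) → f s = 0 := by
    refine isOpen_Ioi.ae_eq_zero_of_integral_contDiff_smul_eq_zero
      (hf.locallyIntegrable.locallyIntegrableOn _) fun η hη hηc hη0 => ?_
    obtain ⟨R, hR0, hηR⟩ : ∃ R : ℝ, 0 ≤ R ∧ ∀ s, R ≤ s → η s = 0 := by
      obtain ⟨R, hR⟩ := hηc.isCompact.isBounded.subset_closedBall (0 : ℝ)
      refine ⟨|R| + 1, by positivity, fun s hs => image_eq_zero_of_notMem_tsupport fun hs' => ?_⟩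
      have := hR hs'
      rw [mem_closedBall, dist_zero_right, Real.norm_eq_abs] at this
      linarith [le_abs_self s, le_abs_self R]
    have hη0' : ∀ s, s ≤ 0 → η s = 0 := fun s hs =>
      image_eq_zero_of_notMem_tsupport fun hs' => not_lt.2 hs (hη0 hs')
    have hηcont := hη.continuous
    have hq : Continuous fun u => η (√u) := by fun_prop
    -- Chosen so that `h' (s ^ 2) = η s` for `s ≥ 0`; starting the integral at `R ^ 2`, beyond the
    -- support of `η`, makes `h` vanish from there on.
    set h : ℝ → ℝ := fun u => ∫ t in (R ^ 2)..u, η (√t) with hh_def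
    have hh : ∀ u, HasDerivAt h (η (√u)) u := fun u =>
      intervalIntegral.integral_hasDerivAt_right (hq.intervalIntegrable _ _)
        (hq.stronglyMeasurableAtFilter _ _) hq.continuousAt
    have hhR : ∀ u, R ^ 2 ≤ u → h u = 0 := by
      intro u hu
      have : ∀ t ∈ uIcc (R ^ 2) u, η (√t) = 0 := fun t ht => by
        rw [uIcc_of_le hu] at ht
        exact hηR _ (Real.le_sqrt_of_sq_le ht.1)
      rw [hh_def]
      simp only
      rw [intervalIntegral.integral_congr this]
      simp
    have hid := integral_radial_smul_laplacian ν hv x hh hq hhR hR0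
    have hred : ∀ {p : ℝ → W}, (∀ s, R ≤ s → p s = 0) →
        ∫ s in Ioi (0 : ℝ), p s = ∫ s in (0 : ℝ)..R, p s := by
      intro p hp
      rw [intervalIntegral.integral_of_le hR0]
      refine setIntegral_eq_of_subset_of_forall_sdiff_eq_zero measurableSet_Ioi
        Ioc_subset_Ioi_self fun s hs => hp s ?_
      by_contra hlt
      exact hs.2 ⟨hs.1, (not_le.1 hlt).le⟩
    have hsqrt : ∀ s : ℝ, 0 < s → √(s ^ 2) = s := fun s hs => Real.sqrt_sq hs.le
    rw [hred (fun s hs => by rw [hhR _ (pow_le_pow_left₀ hR0 hs 2)]; simp),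
      hred (fun s hs => by
        rw [Real.sqrt_sq (hR0.trans hs), hηR s hs]; simp)] at hid
    have hk : ∀ s, HasDerivAt (fun s => h (s ^ 2)) (η (√(s ^ 2)) * (2 * s)) s := by
      intro s
      have hsq : HasDerivAt (fun s : ℝ => s ^ 2) (2 * s) s := by simpa using hasDerivAt_pow 2 s
      exact (hh (s ^ 2)).comp s hsq
    -- Integration by parts: the boundary terms vanish because `h (R ^ 2) = 0` and `H 0 = 0`.
    have hparts : ∫ s in (0 : ℝ)..R, h (s ^ 2) • (s ^ n • L s) =
        -∫ s in (0 : ℝ)..R, (η (√(s ^ 2)) * (2 * s)) • H s := by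
      have hkc : Continuous fun s : ℝ => η (√(s ^ 2)) * (2 * s) := by fun_prop
      rw [intervalIntegral.integral_smul_deriv_eq_deriv_smul (fun s _ => hk s) (fun s _ => hHd s)
        (hkc.intervalIntegrable _ _) (hg.intervalIntegrable _ _), hhR _ le_rfl]
      simp [hH_def]
    have hcomm : ∫ s in (0 : ℝ)..R, s ^ n • (h (s ^ 2) • L s) =
        ∫ s in (0 : ℝ)..R, h (s ^ 2) • (s ^ n • L s) :=
      intervalIntegral.integral_congr fun s _ => smul_comm _ _ _
    rw [hcomm, hparts, neg_inj] at hid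
    calc ∫ s, η s • f s = ∫ s in Ioi (0 : ℝ), η s • f s := by
          refine (setIntegral_eq_integral_of_forall_compl_eq_zero fun s hs => ?_).symm
          rw [hη0' s (not_lt.1 hs), zero_smul]
      _ = ∫ s in (0 : ℝ)..R, η s • f s := hred fun s hs => by rw [hηR s hs, zero_smul]
      _ = ∫ s in (0 : ℝ)..R, (s ^ n • ((2 * s * η (√(s ^ 2))) • S s) -
            (η (√(s ^ 2)) * (2 * s)) • H s) := by
          refine intervalIntegral.integral_congr fun s hs => ?_
          rw [uIcc_of_le hR0] at hs
          simp only [hf_def, Real.sqrt_sq hs.1, smul_sub, smul_smul]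
          congr 2
          ring
      _ = 0 := by
          rw [intervalIntegral.integral_sub
            (Continuous.intervalIntegrable (by fun_prop) _ _)
            (Continuous.intervalIntegrable (by fun_prop) _ _), hid, sub_self]
  have hzero : EqOn f 0 (Ioi 0) :=
    Measure.eqOn_open_of_ae_eq ((ae_restrict_iff' measurableSet_Ioi).2 key) isOpen_Ioi
      hf.continuousOn continuousOn_const
  have := hzero hρ
  simp only [hf_def, Pi.zero_apply, smul_eq_zero] at this
  rcases this with h0 | h0
  · linarith
  · exact sub_eq_zero.1 h0

end Flux

end MeanFlux

/-! ### The power series of the mean and of the flux -/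

namespace MeanFlux

/-- The coefficients of the radial solution `∑ₖ aₖ s ^ (2 k)`, `a₀ = 1`, of `Δu = c u` in
dimension `d`. -/
noncomputable def radialCoeff (c : ℝ) (d : ℕ) : ℕ → ℝ
  | 0 => 1
  | k + 1 => c * radialCoeff c d k / ((2 * k + 2) * (2 * k + d))

theorem radialCoeff_nonneg {c : ℝ} (hc : 0 ≤ c) (d k : ℕ) : 0 ≤ radialCoeff c d k := by
  induction k with
  | zero => simp [radialCoeff]
  | succ k ih => rw [radialCoeff]; positivity

/-- A crude bound, enough to compare the flux series with an exponential series. -/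
theorem radialCoeff_le {c : ℝ} (hc : 0 ≤ c) {d : ℕ} (hd : 1 ≤ d) (k : ℕ) :
    radialCoeff c d k ≤ c ^ k / k.factorial := by
  induction k with
  | zero => simp [radialCoeff]
  | succ k ih =>
    have hd' : (1 : ℝ) ≤ d := by exact_mod_cast hd
    rw [radialCoeff, pow_succ', Nat.factorial_succ, Nat.cast_mul, mul_div_assoc,
      show c * c ^ k / (((k + 1 : ℕ) : ℝ) * (k.factorial : ℝ)) =
        c * ((c ^ k / k.factorial) / (k + 1 : ℕ)) by field_simp]
    refine mul_le_mul_of_nonneg_left ?_ hc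
    push_cast
    have h0 := radialCoeff_nonneg hc d k
    have hk : (0 : ℝ) ≤ k := k.cast_nonneg
    exact div_le_div₀ (h0.trans ih) ih (by positivity) (by nlinarith)

/-- The recursion divides by `4 (k + 1) (k + d / 2)`, which the factorial and the functional
equation of `Γ` absorb. -/
theorem radialCoeff_eq_Gamma (c : ℝ) {d : ℕ} (hd : 1 ≤ d) (k : ℕ) :
    radialCoeff c d k = c ^ k * Real.Gamma (d / 2) /
      (4 ^ k * k.factorial * Real.Gamma (k + d / 2)) := by
  have hd' : (0 : ℝ) < d := by exact_mod_cast hd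
  induction k with
  | zero =>
    have : Real.Gamma ((d : ℝ) / 2) ≠ 0 := (Real.Gamma_pos_of_pos (by positivity)).ne'
    simp [radialCoeff, this]
  | succ k ih =>
    have hG : Real.Gamma ((k : ℝ) + d / 2) ≠ 0 := (Real.Gamma_pos_of_pos (by positivity)).ne'
    have hpos : (k : ℝ) + d / 2 ≠ 0 := by positivity
    rw [radialCoeff, ih, Nat.factorial_succ, Nat.cast_mul,
      show ((k + 1 : ℕ) : ℝ) + (d : ℝ) / 2 = (k + d / 2) + 1 by push_cast; ring,
      Real.Gamma_add_one hpos]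
    have h2 : (2 * (k : ℝ) + d) ≠ 0 := by positivity
    push_cast
    field_simp
    ring

section Iteration

variable {W : Type*} [NormedAddCommGroup W] [NormedSpace ℝ W]

/-- The flux remainder, in terms of the remainder of the mean. -/
theorem norm_flux_sub_le [CompleteSpace W] {d : ℕ} (hd : 1 ≤ d) {c r : ℝ} (hc : 0 ≤ c) {F : ℝ → W} {S : ℝ → W}
    (hF : Continuous F)
    (hflux : ∀ ρ ∈ Ioc 0 r, ρ ^ (d - 1) • S ρ = c • ∫ s in (0 : ℝ)..ρ, s ^ (d - 1) • F s)
    (a : ℕ → ℝ) (w : W) {A : ℝ} {N : ℕ}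
    (hN : ∀ ρ ∈ Icc 0 r, ‖F ρ - (∑ k ∈ Finset.range N, a k * ρ ^ (2 * k)) • w‖ ≤ A * ρ ^ (2 * N))
    {ρ : ℝ} (hρ : ρ ∈ Ioc 0 r) :
    ‖ρ ^ (d - 1) • S ρ -
        (∑ k ∈ Finset.range N, c * a k * ρ ^ (2 * k + d) / (2 * k + d)) • w‖ ≤
      c * A * ρ ^ (2 * N + d) / (2 * N + d) := by
  have hpow : ∀ k : ℕ, ∫ s in (0 : ℝ)..ρ, s ^ (d - 1) * s ^ (2 * k) =
      ρ ^ (2 * k + d) / (2 * k + d) := by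
    intro k
    simp_rw [← pow_add]
    rw [integral_pow, show d - 1 + 2 * k + 1 = 2 * k + d by omega, zero_pow (by omega), sub_zero]
    congr 1
    rw [Nat.cast_add, Nat.cast_sub hd]
    push_cast
    ring
  have hsum : ∫ s in (0 : ℝ)..ρ, s ^ (d - 1) • ((∑ k ∈ Finset.range N, a k * s ^ (2 * k)) • w) =
      (∑ k ∈ Finset.range N, a k * (ρ ^ (2 * k + d) / (2 * k + d))) • w := by
    simp_rw [smul_smul]
    rw [intervalIntegral.integral_smul_const]
    congr 1
    simp_rw [Finset.mul_sum]
    rw [intervalIntegral.integral_finsetSum fun k _ =>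
      Continuous.intervalIntegrable (by fun_prop) _ _]
    refine Finset.sum_congr rfl fun k _ => ?_
    rw [← hpow, ← intervalIntegral.integral_const_mul]
    congr 1
    funext s
    ring
  have hdiff : ρ ^ (d - 1) • S ρ -
      (∑ k ∈ Finset.range N, c * a k * ρ ^ (2 * k + d) / (2 * k + d)) • w =
      c • ∫ s in (0 : ℝ)..ρ,
        s ^ (d - 1) • (F s - (∑ k ∈ Finset.range N, a k * s ^ (2 * k)) • w) := by
    simp_rw [smul_sub (_ ^ (d - 1))]
    rw [intervalIntegral.integral_sub (Continuous.intervalIntegrable (by fun_prop) _ _)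
      (Continuous.intervalIntegrable (by fun_prop) _ _), hsum, hflux ρ hρ, smul_sub, smul_smul,
      Finset.mul_sum]
    congr 2
    exact Finset.sum_congr rfl fun k _ => by ring
  rw [hdiff, norm_smul, Real.norm_of_nonneg hc, mul_assoc, mul_div_assoc]
  refine mul_le_mul_of_nonneg_left ?_ hc
  calc _ ≤ ∫ s in (0 : ℝ)..ρ, A * (s ^ (d - 1) * s ^ (2 * N)) := by
        refine intervalIntegral.norm_integral_le_of_norm_le hρ.1.le
          (Eventually.of_forall fun s hs => ?_) (Continuous.intervalIntegrable (by fun_prop) _ _)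
        have hs0 : 0 ≤ s ^ (d - 1) := pow_nonneg hs.1.le _
        rw [norm_smul, Real.norm_of_nonneg hs0, mul_left_comm]
        exact mul_le_mul_of_nonneg_left (hN s ⟨hs.1.le, hs.2.trans hρ.2⟩) hs0
    _ = _ := by rw [intervalIntegral.integral_const_mul, hpow, mul_div_assoc]

/-- Taylor remainder of a spherical mean whose flux is governed by `Δu = c u`. -/
theorem norm_mean_sub_le [CompleteSpace W] {d : ℕ} (hd : 1 ≤ d) {c r : ℝ} (hc : 0 ≤ c)
    {F : ℝ → W} {S : ℝ → W} (hFS : ∀ s, HasDerivAt F (S s) s) (hS : Continuous S)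
    (hflux : ∀ ρ ∈ Ioc 0 r, ρ ^ (d - 1) • S ρ = c • ∫ s in (0 : ℝ)..ρ, s ^ (d - 1) • F s)
    {M : ℝ} (hM : ∀ ρ ∈ Icc 0 r, ‖F ρ‖ ≤ M) (N : ℕ) :
    ∀ ρ ∈ Icc 0 r, ‖F ρ - (∑ k ∈ Finset.range N, radialCoeff c d k * ρ ^ (2 * k)) • F 0‖ ≤
      M * radialCoeff c d N * ρ ^ (2 * N) := by
  have hF : Continuous F := continuous_iff_continuousAt.2 fun s => (hFS s).continuousAt
  induction N with
  | zero => intro ρ hρ; simpa [radialCoeff] using hM ρ hρ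
  | succ N ih =>
    intro ρ hρ
    set a := radialCoeff c d
    have hd' : (0 : ℝ) < d := by exact_mod_cast hd
    have hflux' := fun ρ hρ => norm_flux_sub_le hd hc hF hflux a (F 0) ih (ρ := ρ) hρ
    -- Differentiating term `k + 1` of the mean gives term `k` of the flux divided by `s ^ (d - 1)`.
    have hrec : ∀ k, a (k + 1) * (2 * k + 2) = c * a k / (2 * k + d) := by
      intro k
      have : (2 * (k : ℝ) + d) ≠ 0 := by positivity
      simp only [a, radialCoeff]
      field_simp
    set q : ℝ → ℝ := fun s => ∑ k ∈ Finset.range N, c * a k / (2 * k + d) * s ^ (2 * k + 1)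
    have hpd : ∀ s, HasDerivAt
        (fun s => ∑ k ∈ Finset.range (N + 1), a k * s ^ (2 * k)) (q s) s := by
      intro s
      simp_rw [Finset.sum_range_succ' _ N]
      have h1 : HasDerivAt (fun s => ∑ k ∈ Finset.range N, a (k + 1) * s ^ (2 * (k + 1))) (q s)
          s := by
        refine HasDerivAt.fun_sum fun k _ => ?_
        have := (hasDerivAt_pow (2 * (k + 1)) s).const_mul (a (k + 1))
        refine this.congr_deriv ?_
        rw [← hrec, show 2 * (k + 1) - 1 = 2 * k + 1 by omega]
        push_cast
        ring
      simpa using h1.add_const (a 0 * s ^ (2 * 0))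
    have hEd : ∀ s, HasDerivAt
        (fun s => F s - (∑ k ∈ Finset.range (N + 1), a k * s ^ (2 * k)) • F 0)
        (S s - q s • F 0) s := fun s => (hFS s).sub ((hpd s).smul_const (F 0))
    have hq : Continuous q := by fun_prop
    have hE0 : F 0 - (∑ k ∈ Finset.range (N + 1), a k * (0 : ℝ) ^ (2 * k)) • F 0 = 0 := by
      simp [Finset.sum_range_succ', a, radialCoeff]
    have hFTC := intervalIntegral.integral_eq_sub_of_hasDerivAt (a := 0) (b := ρ)
      (fun s _ => hEd s) (Continuous.intervalIntegrable (by fun_prop) _ _)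
    rw [hE0, sub_zero] at hFTC
    -- The new remainder vanishes at `0`, so it is the integral of its derivative, which the flux
    -- estimate bounds after division by `s ^ (d - 1)`.
    rw [← hFTC]
    calc _ ≤ ∫ s in (0 : ℝ)..ρ, c * (M * a N) / (2 * N + d) * s ^ (2 * N + 1) := by
          refine intervalIntegral.norm_integral_le_of_norm_le hρ.1
            (Eventually.of_forall fun s hs => ?_) (Continuous.intervalIntegrable (by fun_prop) _ _)
          have hsd : 0 < s ^ (d - 1) := pow_pos hs.1 _
          have hsplit : ∀ k : ℕ, s ^ (2 * k + d) = s ^ (d - 1) * s ^ (2 * k + 1) := by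
            intro k
            rw [← pow_add]
            congr 1
            omega
          have hb := hflux' s ⟨hs.1, hs.2.trans hρ.2⟩
          have hqs : ∑ k ∈ Finset.range N, c * a k * s ^ (2 * k + d) / (2 * k + d) =
              s ^ (d - 1) * q s := by
            simp only [q, Finset.mul_sum]
            refine Finset.sum_congr rfl fun k _ => ?_
            rw [hsplit]
            ring
          rw [hqs, mul_smul, ← smul_sub, norm_smul, Real.norm_of_nonneg hsd.le, hsplit] at hb
          refine le_of_mul_le_mul_left (hb.trans_eq ?_) hsd
          ring
      _ = M * a (N + 1) * ρ ^ (2 * (N + 1)) := by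
          rw [intervalIntegral.integral_const_mul, integral_pow, zero_pow (by omega), sub_zero]
          have := hrec N
          have h2 : (2 * (N : ℝ) + d) ≠ 0 := by positivity
          have h3 : (2 * (N : ℝ) + 2) ≠ 0 := by positivity
          rw [eq_div_iff h2] at this
          rw [show 2 * N + 1 + 1 = 2 * (N + 1) by ring]
          push_cast
          rw [show (2 * (N : ℝ) + 1 + 1) = 2 * N + 2 by ring, div_mul_div_comm,
            div_eq_iff (by positivity)]
          linear_combination (-M * ρ ^ (2 * (N + 1))) * this

/-- The flux series converges. -/
theorem summable_radialCoeff {d : ℕ} (hd : 1 ≤ d) {c : ℝ} (hc : 0 ≤ c) (r : ℝ) (hr : 0 ≤ r) :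
    Summable fun k : ℕ => c * radialCoeff c d k * r ^ (2 * k + d) / (2 * k + d) := by
  have hd' : (1 : ℝ) ≤ d := by exact_mod_cast hd
  refine Summable.of_nonneg_of_le (fun k => ?_) (fun k => ?_)
    ((Real.summable_pow_div_factorial (c * r ^ 2)).mul_left (c * r ^ d))
  · have := radialCoeff_nonneg hc d k
    positivity
  · have h0 := radialCoeff_nonneg hc d k
    have h1 := radialCoeff_le hc hd k
    have hk : (0 : ℝ) ≤ k := k.cast_nonneg
    refine (div_le_self (by positivity) (by linarith)).trans ?_
    calc c * radialCoeff c d k * r ^ (2 * k + d)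
        ≤ c * (c ^ k / k.factorial) * r ^ (2 * k + d) := by gcongr
      _ = _ := by rw [pow_add, pow_mul, mul_pow]; ring

/-- The flux error after `N` terms is at most `M` times the `N`-th term of the same series, which
tends to zero by summability. -/
theorem flux_eq_tsum [CompleteSpace W] {d : ℕ} (hd : 1 ≤ d) {c r : ℝ} (hc : 0 ≤ c) (hr : 0 < r)
    {F : ℝ → W} {S : ℝ → W} (hFS : ∀ s, HasDerivAt F (S s) s) (hS : Continuous S)
    (hflux : ∀ ρ ∈ Ioc 0 r, ρ ^ (d - 1) • S ρ = c • ∫ s in (0 : ℝ)..ρ, s ^ (d - 1) • F s) :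
    r ^ (d - 1) • S r =
      (∑' k : ℕ, c * radialCoeff c d k * r ^ (2 * k + d) / (2 * k + d)) • F 0 := by
  have hF : Continuous F := continuous_iff_continuousAt.2 fun s => (hFS s).continuousAt
  obtain ⟨M, hM⟩ := (isCompact_Icc (a := (0 : ℝ)) (b := r)).exists_bound_of_continuousOn
    hF.continuousOn
  have hsum := summable_radialCoeff hd hc r hr.le
  have hlim := (hsum.hasSum.tendsto_sum_nat).smul_const (F 0)
  refine tendsto_nhds_unique ?_ hlim
  have hz : Tendsto (fun N : ℕ => M * (c * radialCoeff c d N * r ^ (2 * N + d) / (2 * N + d)))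
      atTop (𝓝 0) := by
    simpa using hsum.tendsto_atTop_zero.const_mul M
  refine tendsto_iff_norm_sub_tendsto_zero.2 (squeeze_zero (fun _ => norm_nonneg _)
    (fun N => ?_) hz)
  rw [norm_sub_rev]
  refine (norm_flux_sub_le hd hc hF hflux _ (F 0)
    (norm_mean_sub_le hd hc hFS hS hflux hM N) ⟨hr, le_rfl⟩).trans_eq ?_
  ring

end Iteration

/-- The flux series, multiplied by the area of the unit sphere, is the Bessel factor of the mean
flux theorem. -/
theorem tsum_radialCoeff_mul_area {d : ℕ} (hd : 1 ≤ d) {μ r : ℝ} (hμ : 0 < μ) (hr : 0 < r) :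
    (∑' k : ℕ, μ ^ 2 * radialCoeff (μ ^ 2) d k * r ^ (2 * k + d) / (2 * k + d)) *
        (d * (√Real.pi ^ d / Real.Gamma (d / 2 + 1))) =
      μ ^ 2 * (2 * Real.pi * r / μ) ^ ((d : ℝ) / 2) * besselI ((d : ℝ) / 2) (μ * r) := by
  have hd' : (0 : ℝ) < d := by exact_mod_cast hd
  rw [besselI, ← tsum_mul_left, ← tsum_mul_right]
  refine tsum_congr fun k => ?_
  have hG : Real.Gamma ((d : ℝ) / 2) ≠ 0 := (Real.Gamma_pos_of_pos (by positivity)).ne'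
  have hGk : Real.Gamma ((k : ℝ) + d / 2) ≠ 0 := (Real.Gamma_pos_of_pos (by positivity)).ne'
  have hpos : (k : ℝ) + d / 2 ≠ 0 := by positivity
  have h2 : (2 * (k : ℝ) + d) ≠ 0 := by positivity
  have hpi : √Real.pi ^ d = Real.pi ^ ((d : ℝ) / 2) := by
    rw [Real.sqrt_eq_rpow, ← Real.rpow_mul_natCast Real.pi_pos.le]
    congr 1
    ring
  have hzpow : (μ * r / 2) ^ (2 * (k : ℝ) + (d : ℝ) / 2) =
      (μ * r / 2) ^ (2 * k) * (μ * r / 2) ^ ((d : ℝ) / 2) := by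
    rw [Real.rpow_add (by positivity), ← Real.rpow_natCast]
    push_cast
    rfl
  -- The real powers of `μ` and of `2` cancel, leaving only an integer power of `r`.
  have hprod : (2 * Real.pi * r / μ) ^ ((d : ℝ) / 2) * (μ * r / 2) ^ ((d : ℝ) / 2) =
      Real.pi ^ ((d : ℝ) / 2) * r ^ d := by
    rw [← Real.mul_rpow (by positivity) (by positivity),
      show 2 * Real.pi * r / μ * (μ * r / 2) = Real.pi * r ^ 2 by field_simp,
      Real.mul_rpow Real.pi_pos.le (by positivity), ← Real.rpow_natCast r 2,
      ← Real.rpow_mul hr.le, ← Real.rpow_natCast r d]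
    congr 2
    push_cast
    ring
  rw [radialCoeff_eq_Gamma _ hd, hpi, hzpow, Real.Gamma_add_one (by positivity),
    Real.Gamma_add_one hpos]
  calc _ = (Real.pi ^ ((d : ℝ) / 2) * r ^ d) * (μ ^ 2 * (μ * r / 2) ^ (2 * k) /
        (k.factorial * (((k : ℝ) + d / 2) * Real.Gamma ((k : ℝ) + d / 2)))) := by
        rw [pow_add, div_pow _ (2 : ℝ), mul_pow μ, pow_mul (2 : ℝ), pow_mul μ, pow_mul r]
        norm_num
        field_simp
    _ = _ := by rw [← hprod]; ring

end MeanFlux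

/-! ### Cutoff, surface measure and the final theorem -/

namespace MeanFlux

/-- The mean flux theorem for a function of class `C²` on the whole space. -/
theorem pow_smul_integral_sphere_fderiv_eq_tsum {E W : Type*} [NormedAddCommGroup E]
    [InnerProductSpace ℝ E] [FiniteDimensional ℝ E] [MeasurableSpace E] [BorelSpace E]
    [Nontrivial E] [NormedAddCommGroup W] [NormedSpace ℝ W] [CompleteSpace W]
    (ν : Measure E) [ν.IsAddHaarMeasure] {v : E → W} (hv : ContDiff ℝ 2 v) {x : E} {r c : ℝ}
    (hr : 0 < r) (hc : 0 ≤ c)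
    (hΔ : ∀ y ∈ closedBall x r, Laplacian.laplacian v y = c • v y) :
    r ^ (finrank ℝ E - 1) •
        ∫ ω : sphere (0 : E) 1, fderiv ℝ v (x + r • (ω : E)) ω ∂ν.toSphere =
      (∑' k : ℕ, c * radialCoeff c (finrank ℝ E) k * r ^ (2 * k + finrank ℝ E) /
        (2 * k + finrank ℝ E)) • ν.toSphere.real univ • v x := by
  have hv' := hv.continuous_fderiv two_ne_zero
  have h := flux_eq_tsum (d := finrank ℝ E) finrank_pos hc hr
    (hasDerivAt_integral_sphere ν (hv.of_le one_le_two) x)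
    (continuous_integral_sphere ν (f := fun s y => fderiv ℝ v (x + s • y) y) (by fun_prop))
    (fun ρ hρ => ?_)
  -- At radius `0` the mean integrates the constant `v x`, which produces the area factor.
  · simpa using h
  · rw [pow_smul_integral_sphere_fderiv ν hv x hρ.1, ← intervalIntegral.integral_smul]
    refine intervalIntegral.integral_congr fun s hs => ?_
    rw [uIcc_of_le hρ.1.le] at hs
    refine Eq.trans (congrArg (s ^ (finrank ℝ E - 1) • ·) ?_) (smul_comm _ c _)
    rw [← integral_smul]
    refine integral_congr_ae (Eventually.of_forall fun ω => hΔ _ ?_)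
    have : ‖s • (ω : E)‖ = s := by simp [norm_smul, abs_of_nonneg hs.1]
    rw [mem_closedBall, dist_eq_norm, add_sub_cancel_left, this]
    exact hs.2.trans hρ.2

/-- A function of class `C²` on an open set agrees near a compact ball in it with a function of
class `C²` on the whole space. -/
theorem exists_contDiff_eventuallyEq {E W : Type*} [NormedAddCommGroup E]
    [InnerProductSpace ℝ E] [FiniteDimensional ℝ E] [NormedAddCommGroup W] [NormedSpace ℝ W]
    {D : Set E} (hD : IsOpen D) {v : E → W} (hv : ContDiffOn ℝ 2 v D) {x : E} {r : ℝ}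
    (hr : 0 < r) (hrD : closedBall x r ⊆ D) :
    ∃ u : E → W, ContDiff ℝ 2 u ∧ ∀ y ∈ closedBall x r, u =ᶠ[𝓝 y] v := by
  obtain ⟨δ, hδ, hδD⟩ := (isCompact_closedBall x r).exists_cthickening_subset_open hD hrD
  rw [cthickening_closedBall hδ.le hr.le] at hδD
  -- `χ` is `1` on a neighbourhood of the closed ball, and its support, the closed ball of radius `r
  -- + δ`, lies in `D`.
  let χ : ContDiffBump x := ⟨r + δ / 2, r + δ, by positivity, by linarith⟩
  refine ⟨fun y => χ y • v y, contDiff_iff_contDiffAt.2 fun y => ?_, fun y hy => ?_⟩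
  · by_cases hy : y ∈ D
    · exact χ.contDiffAt.smul (hv.contDiffAt (hD.mem_nhds hy))
    · have hy' : y ∉ tsupport χ := fun h => hy (hδD (by
        rw [χ.tsupport_eq] at h
        rwa [add_comm δ r]))
      refine contDiffAt_const (c := (0 : W)) |>.congr_of_eventuallyEq ?_
      filter_upwards [notMem_tsupport_iff_eventuallyEq.1 hy'] with z hz
      simp [hz]
  · have hy' : y ∈ ball x χ.rIn := closedBall_subset_ball (show r < r + δ / 2 by linarith) hy
    filter_upwards [χ.eventuallyEq_one_of_mem_ball hy'] with z hz
    simp [hz]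

theorem area_sphere (m : ℕ) (hm : 1 ≤ m) :
    (volume : Measure (EuclideanSpace ℝ (Fin m))).toSphere.real univ =
      m * (√Real.pi ^ m / Real.Gamma (m / 2 + 1)) := by
  have : Nonempty (Fin m) := ⟨⟨0, hm⟩⟩
  have hG : 0 < Real.Gamma ((m : ℝ) / 2 + 1) := Real.Gamma_pos_of_pos (by positivity)
  rw [Measure.toSphere_real_apply_univ, finrank_euclideanSpace_fin, measureReal_def,
    EuclideanSpace.volume_ball]
  simp only [ENNReal.ofReal_one, one_pow, one_mul, Fintype.card_fin]
  rw [ENNReal.toReal_ofReal (by positivity)]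

/-- An embedding transfers integrals to the unit sphere with no measurability assumption on the
integrand, which is needed because `v` is arbitrary outside `D`. -/
theorem measurableEmbedding_sphere {E : Type*} [NormedAddCommGroup E] [NormedSpace ℝ E]
    [FiniteDimensional ℝ E] [MeasurableSpace E] [BorelSpace E] (x : E) {r : ℝ} (hr : r ≠ 0) :
    MeasurableEmbedding fun ω : sphere (0 : E) 1 => x + r • (ω : E) := by
  have := FiniteDimensional.proper_real E
  refine (Continuous.isClosedEmbedding (by fun_prop) fun ω ω' h => ?_).measurableEmbedding
  exact Subtype.ext (smul_right_injective E hr (add_left_cancel h))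

end MeanFlux

open MeanFlux in
theorem theorem9 {𝕜 : Type*} [RCLike 𝕜] (m : ℕ) (hm : 2 ≤ m)
    (D : Set (EuclideanSpace ℝ (Fin m))) (hD_open : IsOpen D) (hD_conn : IsConnected D)
    (μ : ℝ) (hμ : 0 < μ)
    (v : EuclideanSpace ℝ (Fin m) → 𝕜) (hv : ContDiffOn ℝ 2 v D)
    (hv_eq : ∀ y ∈ D, Laplacian.laplacian v y - ((μ ^ 2 : ℝ) : 𝕜) * v y = 0)
    (x : EuclideanSpace ℝ (Fin m)) (r : ℝ) (hball : MeanFlux.IsAdmissibleBall D x r) :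
    MeasureTheory.Integrable (MeanFlux.normalDeriv v x r) (MeanFlux.sphereMeasure x r) ∧
    ∫ y, MeanFlux.normalDeriv v x r y ∂(MeanFlux.sphereMeasure x r) =
      ((μ ^ 2 * (2 * Real.pi * r / μ) ^ ((m : ℝ) / 2) *
        MeanFlux.besselI ((m : ℝ) / 2) (μ * r) : ℝ) : 𝕜) * v x := by
  obtain ⟨hr, hrD⟩ := hball
  rw [closure_ball x hr.ne'] at hrD
  have : Nonempty (Fin m) := ⟨⟨0, by omega⟩⟩
  obtain ⟨u, hu, huv⟩ := exists_contDiff_eventuallyEq hD_open hv hr hrD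
  have hemb := measurableEmbedding_sphere x hr.ne'
  have hu' := hu.continuous_fderiv two_ne_zero
  have hmem : ∀ ω : sphere (0 : EuclideanSpace ℝ (Fin m)) 1,
      x + r • (ω : EuclideanSpace ℝ (Fin m)) ∈ closedBall x r := by
    intro ω
    simp [norm_smul, abs_of_pos hr]
  -- The exterior normal at `x + r ω` is `ω`, and `u` agrees with `v` near each point of the sphere,
  -- so the derivatives agree too.
  have hnormal : ∀ ω : sphere (0 : EuclideanSpace ℝ (Fin m)) 1,
      normalDeriv v x r (x + r • (ω : EuclideanSpace ℝ (Fin m))) =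
        fderiv ℝ u (x + r • (ω : EuclideanSpace ℝ (Fin m))) ω := by
    intro ω
    rw [normalDeriv, sphereNormal, add_sub_cancel_left, inv_smul_smul₀ hr.ne',
      (huv _ (hmem ω)).fderiv_eq]
  have hΔ : ∀ y ∈ closedBall x r, Laplacian.laplacian u y = μ ^ 2 • u y := by
    intro y hy
    rw [(InnerProductSpace.laplacian_congr_nhds (huv y hy)).eq_of_nhds, (huv y hy).eq_of_nhds,
      sub_eq_zero.1 (hv_eq y (hrD hy)), RCLike.real_smul_eq_coe_mul]
  constructor
  · refine Integrable.smul_measure (hemb.integrable_map_iff.2 ?_) ENNReal.ofReal_ne_top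
    simp only [Function.comp_def, hnormal]
    exact integrable_sphere _ (by fun_prop)
  · have hflux := pow_smul_integral_sphere_fderiv_eq_tsum volume hu hr (sq_nonneg μ) hΔ
    rw [finrank_euclideanSpace_fin, smul_smul, area_sphere m (by omega),
      tsum_radialCoeff_mul_area (by omega) hμ hr,
      (huv x (mem_closedBall_self hr.le)).eq_of_nhds] at hflux
    rw [sphereMeasure, integral_smul_measure, hemb.integral_map,
      ENNReal.toReal_ofReal (by positivity)]
    simp only [hnormal]
    rw [hflux, RCLike.real_smul_eq_coe_mul]
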